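/- Let $\Pi$ be an irreducible simply laced diagram, i.e. a finite connected simple graph, with a labelling $\sigma: I=\{1,\dots,n\}\to V(\Pi)$ (a bijection). Let $\mathrm{Spin}(m)$ be the spin group inside the Clifford algebra $\mathrm{Cl}(m)$ of $\mathbb{R}^m$ (with $v^2=-\|v\|^2$), let $S(\alpha)=\cos\alpha+\sin\alpha\, e_1e_2\in\mathrm{Spin}(2)$, and let $\tilde\varepsilon_{12},\tilde\varepsilon_{23}:\mathrm{Spin}(2)\to\mathrm{Spin}(3)$ be induced by $(e_1,e_2)\mapsto(e_1,e_2)$ and $(e_1,e_2)\mapsto(e_2,e_3)$. The standard $\mathrm{Spin}(2)$-amalgam $\mathcal{A}(\Pi,\mathrm{Spin}(2))$ consists of groups $\widetilde K_{ij}=\widetilde K_{ji}$ for $i\neq j\in I$, where $\widetilde K_{ij}=\mathrm{Spin}(3)$ if $\{\sigma(i),\sigma(j)\}$ is an edge and $\widetilde K_{ij}=\mathrm{Spin}(2)\times\mathrm{Spin}(2)$ otherwise, and of connecting monomorphisms $\tilde\phi_{ij}^i,\tilde\phi_{ij}^j:\mathrm{Spin}(2)\to\widetilde K_{ij}$ which,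 for $i<j$, are $\tilde\varepsilon_{12},\tilde\varepsilon_{23}$ for an edge and the two coordinate inclusions otherwise. An enveloping morphism of this amalgam into a group $H$ is a family of homomorphisms $\psi_{ij}:\widetilde K_{ij}\to H$ whose images generate $H$ and such that $\psi_{ij}\circ\tilde\phi_{ij}^j=\psi_{kj}\circ\tilde\phi_{kj}^j$ for all $i\neq j\neq k$. Let $\mathrm{Spin}(\Pi)$, with canonical homomorphisms $\tau_{ij}:\widetilde K_{ij}\to\mathrm{Spin}(\Pi)$, be the canonical universal enveloping group, i.e. the group presented by the generators $\bigcup\widetilde K_{ij}$, all relations in the $\widetilde K_{ij}$, and $\tilde\phi_{ij}^j(x)=\tilde\phi_{kj}^j(x)$ for all $x\in\mathrm{Spin}(2)$ and $i\ne j\ne k$. Let $\mathfrak{g}$ be the split real Kac–Moody algebra of $\Pi$ (generators $h_i,e_i,f_i$ and the Chevalley–Serre relations for the generalized Cartan matrix of $\Pi$), let $\mathfrak{k}$ be its maximal compact subalgebra, i.e. the fixed subalgebra of the Cartan–Chevalley involution $h_i\mapsto -h_i$, $e_i\mapsto -f_i$, $f_i\mapsto -e_i$, and let $Y_i=e_i-f_i\in\mathfrak{k}$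 be the Berman generators. A generalized spin representation is a homomorphism of real Lie algebras $\mu:\mathfrak{k}\to\mathrm{End}(\mathbb{C}^s)$, $s\ge 1$, with $\mu(Y_i)^2=-\tfrac14\mathrm{id}$ for all $i$. (1) Let $\mu$ be any generalized spin representation (in particular, a maximal one), and put $X_i=2\mu(Y_i)$. Then for all $i\neq j\in I$ there are subgroups $H_{ij}\le\mathrm{GL}_s(\mathbb{C})$ and there is an enveloping morphism $\Psi=\{\psi_{ij}\}:\mathcal{A}(\Pi,\mathrm{Spin}(2))\to H:=\langle H_{ij}\mid i\neq j\rangle$ such that $\psi_{ij}(\widetilde K_{ij})=H_{ij}$, such that $\psi_{ij}$ is injective whenever $\{\sigma(i),\sigma(j)\}$ is an edge, and such that $\psi_{ij}(\tilde\phi_{ij}^i(S(\alpha)))=\cos(\alpha)\,\mathrm{id}+\sin(\alpha)X_i$ for all $i\ne j$ and $\alpha\in\mathbb{R}$. (2) The element $-1_{\mathrm{Spin}(\Pi)}:=\tau_{ij}(\tilde\phi_{ij}^i(-1_{\mathrm{Spin}(2)}))$ of $\mathrm{Spin}(\Pi)$ does not depend on the choice of $i\neq j\in I$, and $-1_{\mathrm{Spin}(\Pi)}\neq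 1_{\mathrm{Spin}(\Pi)}$. -/

import Mathlib

/-! The standard `Spin(2)`-amalgam of a simply laced diagram, its universal enveloping group, and
generalized spin representations. -/

noncomputable section

namespace SpinCover

/-! ### Amalgams -/

/-- Unordered pairs `{i, j}` with `i ≠ j`. -/
abbrev Pair (I : Type*) := {p : Sym2 I // ¬ p.IsDiag}

/-- A `U`-amalgam over `I`: groups `G {i,j}` for `i ≠ j`, and for each of the two indices
`i ∈ {i,j}` a monomorphism `φ {i,j} i : U → G {i,j}`, the connecting homomorphism. -/
structure UAmalgam (U : Type*) [Group U] (I : Type*) where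
  /-- the group attached to an unordered pair -/
  G : Pair I → Type
  /-- the group structures -/
  [group : ∀ p, Group (G p)]
  /-- the connecting homomorphisms -/
  φ : ∀ (p : Pair I) (i : I), i ∈ p.1 → (U →* G p)
  φ_injective : ∀ (p : Pair I) (i : I) (hi : i ∈ p.1), Function.Injective (φ p i hi)

attribute [instance] UAmalgam.group

namespace UAmalgam

variable {U : Type*} [Group U] {I : Type*} (A : UAmalgam U I)

/-- An enveloping morphism `τ : A → H` into a group `H`. -/
structure EnvelopingMorphism (H : Type*) [Group H] where
  /-- the enveloping homomorphisms -/
  hom : ∀ p : Pair I, A.G p →* H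
  compat : ∀ (p q : Pair I) (j : I) (hp : j ∈ p.1) (hq : j ∈ q.1),
    (hom p).comp (A.φ p j hp) = (hom q).comp (A.φ q j hq)
  generates : (⨆ p, (hom p).range) = ⊤

/-- The relators of the canonical universal enveloping group: all relations of the groups
`G p`, and the identifications `φ p j x = φ q j x`. -/
inductive Relator : FreeGroup (Σ p, A.G p) → Prop
  | mul (p : Pair I) (x y : A.G p) :
      Relator (FreeGroup.of ⟨p, x⟩ * FreeGroup.of ⟨p, y⟩ * (FreeGroup.of ⟨p, x * y⟩)⁻¹)
  | glue (p q : Pair I) (j : I) (hp : j ∈ p.1) (hq : j ∈ q.1) (x : U) :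
      Relator (FreeGroup.of ⟨p, A.φ p j hp x⟩ * (FreeGroup.of ⟨q, A.φ q j hq x⟩)⁻¹)

/-- The canonical universal enveloping group of an amalgam. -/
abbrev UniversalGroup : Type _ := PresentedGroup {r | A.Relator r}

/-- The canonical homomorphism `G p → G(A)`. -/
def universalHom (p : Pair I) : A.G p →* A.UniversalGroup :=
  MonoidHom.mk' (fun x => PresentedGroup.of ⟨p, x⟩) fun x y => by
    have h : PresentedGroup.mk {r | A.Relator r} _ = 1 :=
      PresentedGroup.one_of_mem (Relator.mul (A := A) p x y)
    rw [map_mul, map_inv, map_mul, mul_inv_eq_one] at h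
    exact h.symm

/-- The canonical universal enveloping morphism. -/
def universalMorphism : A.EnvelopingMorphism A.UniversalGroup where
  hom := A.universalHom
  compat p q j hp hq := by
    ext x
    have h : PresentedGroup.mk {r | A.Relator r} _ = 1 :=
      PresentedGroup.one_of_mem (Relator.glue (A := A) p q j hp hq x)
    rw [map_mul, map_inv, mul_inv_eq_one] at h
    exact h
  generates := by
    rw [eq_top_iff, ← PresentedGroup.closure_range_of, Subgroup.closure_le]
    rintro _ ⟨⟨p, x⟩, rfl⟩
    exact Subgroup.mem_iSup_of_mem p ⟨x, rfl⟩

end UAmalgam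

/-! ### The groups `Spin(n)` -/

/-- The negative definite form `-(x₁² + ⋯ + xₙ²)` on `ℝⁿ`. -/
def negForm (n : ℕ) : QuadraticForm ℝ (Fin n → ℝ) :=
  QuadraticMap.weightedSumSquares ℝ (fun _ : Fin n => (-1 : ℝ))

theorem negForm_apply {n : ℕ} (v : Fin n → ℝ) : negForm n v = -∑ i, v i * v i := by
  simp [negForm, QuadraticMap.weightedSumSquares_apply]

/-- The Clifford algebra `Cl(n)`, in which `v² = -‖v‖²`. -/
abbrev Cl (n : ℕ) := CliffordAlgebra (negForm n)

/-- The group `Spin(n)`. -/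
abbrev Spin (n : ℕ) := spinGroup (negForm n)

/-- The generator `e_i` of `Cl(n)`. -/
def gen {n : ℕ} (i : Fin n) : Cl n := CliffordAlgebra.ι (negForm n) (Pi.single i 1)

theorem gen_mul_self {n : ℕ} (i : Fin n) : gen i * gen i = -1 := by
  rw [gen, CliffordAlgebra.ι_sq_scalar, negForm_apply]
  simp [Pi.single_apply]

theorem gen_mul_gen {n : ℕ} {i j : Fin n} (h : i ≠ j) : gen i * gen j = -(gen j * gen i) := by
  refine CliffordAlgebra.ι_mul_ι_comm_of_isOrtho ?_
  rw [QuadraticMap.isOrtho_def]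
  simp only [negForm_apply, Pi.add_apply, add_mul, mul_add, Finset.sum_add_distrib]
  simp [Pi.single_apply, h, h.symm]

/-- The product of two unit vectors lies in the spin group. -/
theorem ι_mul_ι_mem_spinGroup {n : ℕ} {v w : Fin n → ℝ}
    (hv : negForm n v = -1) (hw : negForm n w = -1) :
    CliffordAlgebra.ι (negForm n) v * CliffordAlgebra.ι (negForm n) w
      ∈ spinGroup (negForm n) := by
  have key : ∀ u : Fin n → ℝ, negForm n u = -1 →
      CliffordAlgebra.ι (negForm n) u ∈ pinGroup (negForm n) := by
    intro u hu
    have h1 : CliffordAlgebra.ι (negForm n) u * CliffordAlgebra.ι (negForm n) u = -1 := by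
      rw [CliffordAlgebra.ι_sq_scalar, hu]; simp
    refine ⟨⟨⟨CliffordAlgebra.ι (negForm n) u, -CliffordAlgebra.ι (negForm n) u,
      by rw [mul_neg, h1, neg_neg], by rw [neg_mul, h1, neg_neg]⟩, ?_, rfl⟩, ?_⟩
    · exact Subgroup.subset_closure ⟨u, rfl⟩
    · rw [SetLike.mem_coe, Unitary.mem_iff]
      simp [h1]
  refine ⟨mul_mem (key v hv) (key w hw), ?_⟩
  exact CliffordAlgebra.ι_mul_ι_mem_evenOdd_zero (negForm n) v w

/-- `S(α) = cos α + sin α e₁e₂ ∈ Spin(2)`. -/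
def S (α : ℝ) : Spin 2 :=
  ⟨algebraMap ℝ (Cl 2) (Real.cos α) + Real.sin α • (gen 0 * gen 1), by
    have h := ι_mul_ι_mem_spinGroup (n := 2) (v := Pi.single 0 1)
      (w := Pi.single 0 (-Real.cos α) + Pi.single 1 (Real.sin α))
      (by rw [negForm_apply]; simp)
      (by
        rw [negForm_apply]
        have := Real.cos_sq_add_sin_sq α
        simp
        nlinarith)
    have h0 : (Pi.single 0 (-Real.cos α) : Fin 2 → ℝ) = (-Real.cos α) • Pi.single 0 1 := by
      ext i; fin_cases i <;> simp
    have h1 : (Pi.single 1 (Real.sin α) : Fin 2 → ℝ) = (Real.sin α) • Pi.single 1 1 := by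
      ext i; fin_cases i <;> simp
    rw [h0, h1, map_add, map_smul, map_smul] at h
    change gen 0 * ((-Real.cos α) • gen 0 + Real.sin α • gen 1) ∈ _ at h
    rw [mul_add, mul_smul_comm, mul_smul_comm, gen_mul_self] at h
    simpa [Algebra.algebraMap_eq_smul_one] using h⟩

/-- The element `-1 ∈ Spin(2)`. -/
def negOne : Spin 2 :=
  ⟨-1, by
    have h := (S Real.pi).2
    simpa [S] using h⟩

/-- The linear isometry `ℝᵐ → ℝⁿ`, `e_i ↦ e_{f i}`, attached to an injection `f`. -/
def coordIsometry {m n : ℕ} (f : Fin m ↪ Fin n) : negForm m →qᵢ negForm n where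
  toLinearMap := Function.ExtendByZero.linearMap ℝ f
  map_app' v := by
    change negForm n (Function.extend f v 0) = negForm m v
    rw [negForm_apply, negForm_apply, neg_inj]
    refine (Finset.sum_of_injOn f f.injective.injOn (by simp) ?_ ?_).symm
    · intro i _ hi
      rw [Function.extend_apply' _ _ _ (by simpa using hi)]
      simp
    · intro i _
      rw [f.injective.extend_apply]

theorem map_mem_spinGroup {m n : ℕ} (f : Fin m ↪ Fin n) {x : Cl m}
    (hx : x ∈ spinGroup (negForm m)) :
    CliffordAlgebra.map (coordIsometry f) x ∈ spinGroup (negForm n) := by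
  obtain ⟨⟨hl, hu⟩, he⟩ := hx
  have hstar : ∀ y : Cl m, star (CliffordAlgebra.map (coordIsometry f) y) =
      CliffordAlgebra.map (coordIsometry f) (star y) := by
    intro y
    induction y using CliffordAlgebra.induction with
    | algebraMap r => simp [CliffordAlgebra.star_algebraMap]
    | ι v => simp
    | mul a b ha hb => simp [ha, hb]
    | add a b ha hb => simp [ha, hb]
  refine ⟨⟨?_, ?_⟩, ?_⟩
  · obtain ⟨u, hu', rfl⟩ := hl
    refine ⟨Units.map (CliffordAlgebra.map (coordIsometry f)).toMonoidHom u, ?_, rfl⟩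
    have hle : lipschitzGroup (negForm m) ≤ (lipschitzGroup (negForm n)).comap
        (Units.map (CliffordAlgebra.map (coordIsometry f)).toMonoidHom) := by
      rw [lipschitzGroup, Subgroup.closure_le]
      rintro w ⟨v, hv⟩
      refine Subgroup.subset_closure ⟨coordIsometry f v, ?_⟩
      rw [← CliffordAlgebra.map_apply_ι, hv]
      rfl
    exact hle hu'
  · rw [SetLike.mem_coe, Unitary.mem_iff] at hu ⊢
    rw [hstar, ← map_mul, ← map_mul, hu.1, hu.2]
    simp
  · change _ ∈ CliffordAlgebra.evenOdd (negForm n) 0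
    have he' : x ∈ CliffordAlgebra.evenOdd (negForm m) 0 := he
    clear hl hu he
    induction x, he' using CliffordAlgebra.even_induction with
    | algebraMap r =>
      rw [AlgHom.commutes]
      exact (CliffordAlgebra.even (negForm n)).algebraMap_mem r
    | add x y hx hy ihx ihy =>
      rw [map_add]
      exact add_mem ihx ihy
    | ι_mul_ι_mul v w x hx ih =>
      rw [map_mul, map_mul, CliffordAlgebra.map_apply_ι, CliffordAlgebra.map_apply_ι]
      exact (CliffordAlgebra.even (negForm n)).mul_mem
        (CliffordAlgebra.ι_mul_ι_mem_evenOdd_zero (negForm n) _ _) ih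

/-- The embedding `Spin(m) → Spin(n)` induced by `e_i ↦ e_{f i}`. -/
def spinMap {m n : ℕ} (f : Fin m ↪ Fin n) : Spin m →* Spin n where
  toFun x := ⟨CliffordAlgebra.map (coordIsometry f) x, map_mem_spinGroup f x.2⟩
  map_one' := Subtype.ext (map_one _)
  map_mul' _ _ := Subtype.ext (map_mul _ _ _)

theorem spinMap_injective {n : ℕ} (f : Fin 2 ↪ Fin n) : Function.Injective (spinMap f) := by
  let e₁ : (CliffordAlgebraQuaternion.Q (-1 : ℝ) (-1)).IsometryEquiv (negForm 2) :=
    { (LinearEquiv.finTwoArrow ℝ ℝ).symm with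
      map_app' := fun v => by
        change negForm 2 ((LinearEquiv.finTwoArrow ℝ ℝ).symm v) = _
        rw [negForm_apply]
        simp
        ring }
  let e : Quaternion ℝ ≃ₐ[ℝ] Cl 2 :=
    (CliffordAlgebraQuaternion.equiv (c₁ := (-1 : ℝ)) (c₂ := -1)).symm.trans
      (CliffordAlgebra.equivOfIsometry e₁)
  have hinj : Function.Injective (CliffordAlgebra.map (coordIsometry f)) := by
    have h := ((CliffordAlgebra.map (coordIsometry f)).comp e.toAlgHom).toRingHom.injective
    intro x y hxy
    apply e.symm.injective
    apply h
    simpa using hxy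
  intro x y hxy
  exact Subtype.ext (hinj (congrArg Subtype.val hxy))

/-- `ε₁₂ : Spin(2) → Spin(3)`, `e₁ ↦ e₁`, `e₂ ↦ e₂`. -/
def ε₁₂ : Spin 2 →* Spin 3 := spinMap Fin.castSuccEmb

/-- `ε₂₃ : Spin(2) → Spin(3)`, `e₁ ↦ e₂`, `e₂ ↦ e₃`. -/
def ε₂₃ : Spin 2 →* Spin 3 := spinMap (Fin.succEmb 2)

/-! ### The standard `Spin(2)`-amalgam of a simply laced diagram -/

/-- `Spin(3)` for an edge, `Spin(2) × Spin(2)` for a non-edge. -/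
def Piece : Bool → Type
  | true => Spin 3
  | false => Spin 2 × Spin 2

instance : ∀ b, Group (Piece b)
  | true => inferInstanceAs (Group (Spin 3))
  | false => inferInstanceAs (Group (Spin 2 × Spin 2))

/-- The connecting homomorphism for the smaller index of a pair. -/
def pieceFst : ∀ b, Spin 2 →* Piece b
  | true => ε₁₂
  | false => MonoidHom.inl (Spin 2) (Spin 2)

/-- The connecting homomorphism for the larger index of a pair. -/
def pieceSnd : ∀ b, Spin 2 →* Piece b
  | true => ε₂₃
  | false => MonoidHom.inr (Spin 2) (Spin 2)

/-- `{i, j}^σ ∈ E(Π)`. -/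
def IsEdge {n : ℕ} {V : Type*} (D : SimpleGraph V) (σ : Fin n ≃ V) (p : Pair (Fin n)) : Prop :=
  p.1.map σ ∈ D.edgeSet

open Classical in
/-- The standard `Spin(2)`-amalgam of the simply laced diagram `D` with labelling `σ`.
A simply laced diagram is a simple graph. -/
def spinAmalgam {n : ℕ} {V : Type*} (D : SimpleGraph V) (σ : Fin n ≃ V) :
    UAmalgam (Spin 2) (Fin n) where
  G p := Piece (decide (IsEdge D σ p))
  φ p i _ := if i = p.1.inf then pieceFst _ else pieceSnd _
  φ_injective p i _ := by
    generalize decide (IsEdge D σ p) = b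
    split_ifs <;> cases b
    · exact fun x y h => congrArg Prod.fst h
    · exact spinMap_injective _
    · exact fun x y h => congrArg Prod.snd h
    · exact spinMap_injective _

/-- The spin group `Spin(Π)`. -/
abbrev SpinOf {n : ℕ} {V : Type*} (D : SimpleGraph V) (σ : Fin n ≃ V) :=
  (spinAmalgam D σ).UniversalGroup

/-- The element `τ_{ij}(φ_{ij}^i(-1))` of `Spin(Π)`. -/
def negOneAt {n : ℕ} {V : Type*} (D : SimpleGraph V) (σ : Fin n ≃ V)
    (p : Pair (Fin n)) (i : Fin n) (hi : i ∈ p.1) : SpinOf D σ :=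
  (spinAmalgam D σ).universalMorphism.hom p ((spinAmalgam D σ).φ p i hi negOne)

/-! ### The Kac–Moody algebra, its maximal compact subalgebra, generalized spin representations -/

open Classical in
/-- The generalized Cartan matrix of a simply laced diagram. -/
def cartan {n : ℕ} {V : Type*} (D : SimpleGraph V) (σ : Fin n ≃ V) :
    Matrix (Fin n) (Fin n) ℤ :=
  fun i j => if i = j then 2 else if D.Adj (σ i) (σ j) then -1 else 0

section KacMoody

variable {n : ℕ} (A : Matrix (Fin n) (Fin n) ℤ)

/-- The split real Kac–Moody algebra of `A`: generators `h_i`, `e_i`, `f_i` and the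
Chevalley–Serre relations. -/
abbrev KacMoody := A.ToLieAlgebra ℝ

open CartanMatrix

/-- The quotient homomorphism from the free Lie algebra. -/
def kmMk : FreeLieAlgebra ℝ (Generators (Fin n)) →ₗ⁅ℝ⁆ KacMoody A where
  toFun := LieSubmodule.Quotient.mk (N := Relations.toIdeal ℝ A)
  map_add' _ _ := rfl
  map_smul' _ _ := rfl
  map_lie' := rfl

theorem kmMk_eq_zero {x : FreeLieAlgebra ℝ (Generators (Fin n))}
    (hx : x ∈ Relations.toSet ℝ A) : kmMk A x = 0 :=
  LieSubmodule.Quotient.mk_eq_zero'.mpr (LieSubmodule.subset_lieSpan hx)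

/-- The generator `h_i` of the Kac–Moody algebra. -/
def kmH (i : Fin n) : KacMoody A := kmMk A (FreeLieAlgebra.of ℝ (Generators.H i))

/-- The generator `e_i` of the Kac–Moody algebra. -/
def kmE (i : Fin n) : KacMoody A := kmMk A (FreeLieAlgebra.of ℝ (Generators.E i))

/-- The generator `f_i` of the Kac–Moody algebra. -/
def kmF (i : Fin n) : KacMoody A := kmMk A (FreeLieAlgebra.of ℝ (Generators.F i))

theorem map_ad_pow {L L' : Type*} [LieRing L] [LieAlgebra ℝ L] [LieRing L'] [LieAlgebra ℝ L']
    (φ : L →ₗ⁅ℝ⁆ L') (x y : L) (k : ℕ) :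
    φ ((LieAlgebra.ad ℝ L x ^ k) y) = (LieAlgebra.ad ℝ L' (φ x) ^ k) (φ y) := by
  induction k with
  | zero => simp
  | succ k ih => simp [pow_succ', ih]

theorem ad_neg_pow {L : Type*} [LieRing L] [LieAlgebra ℝ L] (x y : L) (k : ℕ)
    (h : (LieAlgebra.ad ℝ L x ^ k) y = 0) : ((-LieAlgebra.ad ℝ L x) ^ k) y = 0 := by
  rw [neg_pow]
  rcases neg_one_pow_eq_or (Module.End ℝ L) k with hk | hk <;> simp [hk, h]

theorem km_hh (i j : Fin n) : ⁅kmH A i, kmH A j⁆ = 0 :=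
  kmMk_eq_zero A (x := Relations.HH ℝ (i, j)) (by simp [Relations.toSet])

theorem km_ef (i : Fin n) : ⁅kmE A i, kmF A i⁆ = kmH A i := by
  have h := kmMk_eq_zero A (x := Relations.EF ℝ (i, i)) (by simp [Relations.toSet])
  simpa [Relations.EF, sub_eq_zero, kmE, kmF, kmH] using h

theorem km_ef_ne {i j : Fin n} (hij : i ≠ j) : ⁅kmE A i, kmF A j⁆ = 0 := by
  have h := kmMk_eq_zero A (x := Relations.EF ℝ (i, j)) (by simp [Relations.toSet])
  simpa [Relations.EF, hij, kmE, kmF, kmH] using h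

theorem km_he (i j : Fin n) : ⁅kmH A i, kmE A j⁆ = A i j • kmE A j := by
  have h := kmMk_eq_zero A (x := Relations.HE ℝ A (i, j)) (by simp [Relations.toSet])
  simpa [Relations.HE, sub_eq_zero, kmE, kmF, kmH] using h

theorem km_hf (i j : Fin n) : ⁅kmH A i, kmF A j⁆ = -(A i j • kmF A j) := by
  have h := kmMk_eq_zero A (x := Relations.HF ℝ A (i, j)) (by simp [Relations.toSet])
  simpa [Relations.HF, add_eq_zero_iff_eq_neg, kmE, kmF, kmH] using h

theorem km_adE (i j : Fin n) :
    (LieAlgebra.ad ℝ _ (kmE A i) ^ (-A i j).toNat) ⁅kmE A i, kmE A j⁆ = 0 := by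
  have h := kmMk_eq_zero A (x := Relations.adE ℝ A (i, j)) (by simp [Relations.toSet])
  simpa [Relations.adE, map_ad_pow, kmE] using h

theorem km_adF (i j : Fin n) :
    (LieAlgebra.ad ℝ _ (kmF A i) ^ (-A i j).toNat) ⁅kmF A i, kmF A j⁆ = 0 := by
  have h := kmMk_eq_zero A (x := Relations.adF ℝ A (i, j)) (by simp [Relations.toSet])
  simpa [Relations.adF, map_ad_pow, kmF] using h

/-- The Cartan–Chevalley involution on free generators:
`h_i ↦ -h_i`, `e_i ↦ -f_i`, `f_i ↦ -e_i`. -/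
def chevalleyFree : FreeLieAlgebra ℝ (Generators (Fin n)) →ₗ⁅ℝ⁆ KacMoody A :=
  FreeLieAlgebra.lift ℝ fun g => match g with
    | Generators.H i => -kmH A i
    | Generators.E i => -kmF A i
    | Generators.F i => -kmE A i

theorem chevalleyFree_H (i : Fin n) :
    chevalleyFree A (FreeLieAlgebra.of ℝ (Generators.H i)) = -kmH A i :=
  FreeLieAlgebra.lift_of_apply ..

theorem chevalleyFree_E (i : Fin n) :
    chevalleyFree A (FreeLieAlgebra.of ℝ (Generators.E i)) = -kmF A i :=
  FreeLieAlgebra.lift_of_apply ..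

theorem chevalleyFree_F (i : Fin n) :
    chevalleyFree A (FreeLieAlgebra.of ℝ (Generators.F i)) = -kmE A i :=
  FreeLieAlgebra.lift_of_apply ..

theorem toIdeal_le_ker : Relations.toIdeal ℝ A ≤ (chevalleyFree A).ker := by
  rw [Relations.toIdeal, LieSubmodule.lieSpan_le]
  intro x hx
  rw [SetLike.mem_coe, LieHom.mem_ker]
  rcases hx with ((((⟨⟨i, j⟩, rfl⟩ | ⟨⟨i, j⟩, rfl⟩) | ⟨⟨i, j⟩, rfl⟩) | ⟨⟨i, j⟩, rfl⟩) |
    ⟨⟨i, j⟩, rfl⟩) | ⟨⟨i, j⟩, rfl⟩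
  · simp [Relations.HH, chevalleyFree_H, km_hh]
  · by_cases hij : i = j
    · subst hij
      have := km_ef A i
      rw [← lie_skew] at this
      simp [Relations.EF, chevalleyFree_H, chevalleyFree_E, chevalleyFree_F, ← this]
    · have := km_ef_ne A (Ne.symm hij)
      rw [← lie_skew, neg_eq_zero] at this
      simp [Relations.EF, hij, chevalleyFree_E, chevalleyFree_F, this]
  · simp [Relations.HE, chevalleyFree_H, chevalleyFree_E, km_hf]
  · simp [Relations.HF, chevalleyFree_H, chevalleyFree_F, km_he]
  · simp [Relations.adE, map_ad_pow, chevalleyFree_E, ad_neg_pow _ _ _ (km_adF A i j)]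
  · simp [Relations.adF, map_ad_pow, chevalleyFree_F, ad_neg_pow _ _ _ (km_adE A i j)]

/-- The Cartan–Chevalley involution `ω` of the Kac–Moody algebra. -/
def chevalley : KacMoody A →ₗ⁅ℝ⁆ KacMoody A where
  toLinearMap := (Relations.toIdeal ℝ A).toSubmodule.liftQ (chevalleyFree A).toLinearMap
    (fun _ hx => toIdeal_le_ker A hx)
  map_lie' {x y} := by
    obtain ⟨x, rfl⟩ := Submodule.mkQ_surjective _ x
    obtain ⟨y, rfl⟩ := Submodule.mkQ_surjective _ y
    exact LieHom.map_lie (chevalleyFree A) x y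

theorem chevalley_kmH (i : Fin n) : chevalley A (kmH A i) = -kmH A i := chevalleyFree_H A i

theorem chevalley_kmE (i : Fin n) : chevalley A (kmE A i) = -kmF A i := chevalleyFree_E A i

theorem chevalley_kmF (i : Fin n) : chevalley A (kmF A i) = -kmE A i := chevalleyFree_F A i

/-- The maximal compact subalgebra: the fixed points of the Cartan–Chevalley involution. -/
def maxCompact : LieSubalgebra ℝ (KacMoody A) where
  carrier := {x | chevalley A x = x}
  add_mem' {x y} hx hy := by
    change chevalley A (x + y) = x + y
    rw [map_add, show chevalley A x = x from hx, show chevalley A y = y from hy]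
  zero_mem' := map_zero (chevalley A)
  smul_mem' c x hx := by
    change chevalley A (c • x) = c • x
    rw [map_smul, show chevalley A x = x from hx]
  lie_mem' {x y} hx hy := by
    change chevalley A ⁅x, y⁆ = ⁅x, y⁆
    rw [LieHom.map_lie, show chevalley A x = x from hx, show chevalley A y = y from hy]

/-- The Berman generators `Y_i = e_i - f_i` of the maximal compact subalgebra. -/
def berman (i : Fin n) : maxCompact A :=
  ⟨kmE A i - kmF A i, by
    change chevalley A (kmE A i - kmF A i) = _
    rw [map_sub, chevalley_kmE, chevalley_kmF]
    abel⟩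

attribute [local instance 100] LieRing.ofAssociativeRing

/-- Representations of the real Lie algebra `maxCompact A` on `ℂˢ`; the bracket of matrices is
the commutator. -/
abbrev CompactRep (s : ℕ) := maxCompact A →ₗ⁅ℝ⁆ Matrix (Fin s) (Fin s) ℂ

variable {A}

/-- A generalized spin representation: every Berman generator is mapped to a matrix whose square
is `-1/4`. -/
def IsGeneralizedSpinRep {s : ℕ} (μ : CompactRep A s) : Prop :=
  ∀ i, μ (berman A i) * μ (berman A i) = -((1 / 4 : ℝ) • (1 : Matrix (Fin s) (Fin s) ℂ))

/-- The matrix `X_i = 2 μ(Y_i)`. -/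
def spinMatrix {s : ℕ} (μ : CompactRep A s) (i : Fin n) : Matrix (Fin s) (Fin s) ℂ :=
  (2 : ℝ) • μ (berman A i)

end KacMoody

end SpinCover

end

/-!
Call a family of elements `X_i` of a real algebra `R`, indexed by the vertices of the diagram, a
spin family if `X_i² = -1`, and `X_i`, `X_j` anticommute along edges and commute otherwise. Every
spin family gives a compatible system of homomorphisms from the amalgam into `Rˣ`:

* `Spin(2)` lies in the even part `ℂ` of `Cl(2)`, and `X_i` extends to
  `cos α + sin α e₁e₂ ↦ cos α + sin α X_i` (`spinTwoHom`);
* at a non-edge the images for `X_i` and `X_j` commute, so their product is a homomorphism on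
  `Spin(2) × Spin(2)`;
* at an edge with anticommuting `X`, `Y` there is an algebra homomorphism `Cl(3) → R` sending
  `e₁e₂` to `X` and `e₂e₃` to `Y` (`clThreeHom`). It is injective on `Spin(3)` because the even
  part of `Cl(3)` is the division ring of quaternions.

For a generalized spin representation `μ`, the matrices `2μ(Y_i)` form a spin family: in the
Kac-Moody algebra `⁅Y_i, Y_j⁆ = 0` at a non-edge and `⁅Y_i, ⁅Y_i, Y_j⁆⁆ = -Y_j` at an edge, and
with `μ(Y_i)² = -1/4` the second relation says that `μ(Y_i)` and `μ(Y_j)` anticommute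
(`isSpinFamily_spinMatrix`). This gives the enveloping morphism.

At an edge both connecting homomorphisms map `-1` to `-1 ∈ Spin(3)`, so by connectedness all the
elements `τ_{ij}(φ_{ij}^i(-1))` coincide (`negOneAt_eq_of_reachable`). Every spin family in a
nontrivial algebra maps this element to `-1 ≠ 1`, so it remains to find one spin family for every
diagram. The translations by `e_i` of functions on `𝔽₂ⁿ`, twisted by the signs `(-1)^{β(e_i, v)}`,
do this if the bilinear form `β` satisfies `β(e_i, e_i) = 1` and, for `i ≠ j`,
`β(e_i, e_j) + β(e_j, e_i) = 1` exactly at the edges (`isSpinFamily_twistedShift`).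
-/

noncomputable section

namespace SpinCover

/-! ### Compatible families of homomorphisms out of an amalgam -/

/-- The universal property of the canonical universal enveloping group. -/
def UAmalgam.lift {U : Type*} [Group U] {I : Type*} (A : UAmalgam U I) {H : Type*} [Group H]
    (f : ∀ p, A.G p →* H)
    (hf : ∀ (p q : Pair I) (j : I) (hp : j ∈ p.1) (hq : j ∈ q.1),
      (f p).comp (A.φ p j hp) = (f q).comp (A.φ q j hq)) :
    A.UniversalGroup →* H :=
  PresentedGroup.toGroup (f := fun x : Σ p, A.G p => f x.1 x.2) <| by
    rintro _ (⟨p, x, y⟩ | ⟨p, q, j, hp, hq, x⟩)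
    · simp
    · simpa [mul_inv_eq_one] using DFunLike.congr_fun (hf p q j hp hq) x

theorem UAmalgam.lift_universalHom {U : Type*} [Group U] {I : Type*} (A : UAmalgam U I)
    {H : Type*} [Group H] (f : ∀ p, A.G p →* H)
    (hf : ∀ (p q : Pair I) (j : I) (hp : j ∈ p.1) (hq : j ∈ q.1),
      (f p).comp (A.φ p j hp) = (f q).comp (A.φ q j hq)) (p : Pair I) (x : A.G p) :
    A.lift f hf (A.universalHom p x) = f p x :=
  PresentedGroup.toGroup.of _

/-- A compatible family of homomorphisms is an enveloping morphism into the subgroup generated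
by its images. -/
def UAmalgam.EnvelopingMorphism.ofHoms {U : Type*} [Group U] {I : Type*} {A : UAmalgam U I}
    {H : Type*} [Group H] (f : ∀ p, A.G p →* H)
    (hf : ∀ (p q : Pair I) (j : I) (hp : j ∈ p.1) (hq : j ∈ q.1),
      (f p).comp (A.φ p j hp) = (f q).comp (A.φ q j hq)) :
    A.EnvelopingMorphism ↥(⨆ p, (f p).range) where
  hom p := (f p).codRestrict _ fun x => Subgroup.mem_iSup_of_mem p ⟨x, rfl⟩
  compat p q j hp hq := by
    ext x
    exact DFunLike.congr_fun (hf p q j hp hq) x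
  generates := by
    apply Subgroup.map_injective (Subgroup.subtype_injective (⨆ p, (f p).range))
    rw [Subgroup.map_iSup, ← MonoidHom.range_eq_map, Subgroup.range_subtype]
    refine iSup_congr fun p => ?_
    rw [MonoidHom.map_range]
    rfl

/-! ### Even Clifford algebras in low dimension -/

theorem ι_eq_sum_gen {n : ℕ} (v : Fin n → ℝ) :
    CliffordAlgebra.ι (negForm n) v = ∑ i, v i • gen i := by
  conv_lhs => rw [pi_eq_sum_univ' v]
  simp [gen, map_sum, map_smul]

/-- The even Clifford algebra is generated by the products `e_i e_j`. -/
theorem mem_of_mem_evenOdd_zero {n : ℕ} (T : Subalgebra ℝ (Cl n))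
    (h : ∀ i j : Fin n, gen i * gen j ∈ T) {x : Cl n}
    (hx : x ∈ CliffordAlgebra.evenOdd (negForm n) 0) : x ∈ T := by
  induction x, hx using CliffordAlgebra.even_induction with
  | algebraMap r => exact T.algebraMap_mem r
  | add x y _ _ hx hy => exact add_mem hx hy
  | ι_mul_ι_mul v w x _ hx =>
    refine mul_mem ?_ hx
    rw [ι_eq_sum_gen, ι_eq_sum_gen, Finset.sum_mul_sum]
    refine sum_mem fun i _ => sum_mem fun j _ => ?_
    rw [smul_mul_smul_comm]
    exact T.smul_mem (h i j) _

theorem gen_mul_gen_mul_self {n : ℕ} {i j : Fin n} (h : i ≠ j) :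
    gen i * gen j * (gen i * gen j) = -1 := by
  rw [mul_assoc, ← mul_assoc (gen j), gen_mul_gen h.symm, neg_mul, mul_neg, mul_assoc (gen i),
    gen_mul_self, mul_neg, mul_neg, mul_one, neg_neg, gen_mul_self]

/-- The embedding `ℂ → Cl(2)`, `I ↦ e₁e₂`. -/
def complexToCl : ℂ →ₐ[ℝ] Cl 2 :=
  Complex.liftAux (gen 0 * gen 1) (gen_mul_gen_mul_self (by decide))

theorem spin_two_mem_range (x : Spin 2) : ∃ z, complexToCl z = x.1 := by
  have h01 : gen 0 * gen 1 ∈ complexToCl.range := ⟨Complex.I, Complex.liftAux_apply_I _ _⟩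
  refine mem_of_mem_evenOdd_zero complexToCl.range (fun i j => ?_) x.2.2
  fin_cases i <;> fin_cases j
  · simp [gen_mul_self]
  · exact h01
  · simpa [gen_mul_gen (show (1 : Fin 2) ≠ 0 by decide)] using neg_mem h01
  · simp [gen_mul_self]

/-- The inclusion of `Spin(2)` into the even part of `Cl(2)`, identified with `ℂ` by `e₁e₂ ↦ I`. -/
def spinTwoToComplex : Spin 2 →* ℂ where
  toFun x := (spin_two_mem_range x).choose
  map_one' := complexToCl.toRingHom.injective <| by
    simpa using (spin_two_mem_range 1).choose_spec
  map_mul' x y := complexToCl.toRingHom.injective <| by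
    have h1 := (spin_two_mem_range x).choose_spec
    have h2 := (spin_two_mem_range y).choose_spec
    have h3 := (spin_two_mem_range (x * y)).choose_spec
    simp only [AlgHom.toRingHom_eq_coe, RingHom.coe_coe, map_mul, h1, h2, h3]
    rfl

theorem complexToCl_spinTwoToComplex (x : Spin 2) : complexToCl (spinTwoToComplex x) = x.1 :=
  (spin_two_mem_range x).choose_spec

theorem spinTwoToComplex_S (α : ℝ) :
    spinTwoToComplex (S α) = ⟨Real.cos α, Real.sin α⟩ :=
  complexToCl.toRingHom.injective <| by
    refine (complexToCl_spinTwoToComplex _).trans ?_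
    change (S α).1 = complexToCl _
    rw [complexToCl, Complex.liftAux_apply]
    rfl

theorem negOne_eq_S_pi : negOne = S Real.pi := Subtype.ext <| by simp [negOne, S]

/-- The quaternion basis `e₁e₂`, `e₂e₃`, `-e₁e₃` of the even part of `Cl(3)`. -/
def quaternionBasis : QuaternionAlgebra.Basis (Cl 3) (-1 : ℝ) 0 (-1) where
  i := gen 0 * gen 1
  j := gen 1 * gen 2
  k := -(gen 0 * gen 2)
  i_mul_i := by simp [gen_mul_gen_mul_self (show (0 : Fin 3) ≠ 1 by decide)]
  j_mul_j := by simp [gen_mul_gen_mul_self (show (1 : Fin 3) ≠ 2 by decide)]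
  i_mul_j := by
    rw [mul_assoc, ← mul_assoc (gen 1), gen_mul_self]
    simp
  j_mul_i := by
    rw [gen_mul_gen (show (1 : Fin 3) ≠ 2 by decide),
      gen_mul_gen (show (0 : Fin 3) ≠ 1 by decide), neg_mul_neg, mul_assoc,
      ← mul_assoc (gen 1), gen_mul_self, gen_mul_gen (show (0 : Fin 3) ≠ 2 by decide)]
    simp

/-- The embedding of Hamilton's quaternions into `Cl(3)`, `i ↦ e₁e₂`, `j ↦ e₂e₃`. -/
def quaternionToCl : Quaternion ℝ →ₐ[ℝ] Cl 3 := quaternionBasis.liftHom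

theorem spin_three_mem_range (x : Spin 3) : x.1 ∈ quaternionToCl.range := by
  have h01 : gen 0 * gen 1 ∈ quaternionToCl.range := ⟨⟨0, 1, 0, 0⟩, by
    change quaternionBasis.lift _ = _
    simp [QuaternionAlgebra.Basis.lift, quaternionBasis]⟩
  have h12 : gen 1 * gen 2 ∈ quaternionToCl.range := ⟨⟨0, 0, 1, 0⟩, by
    change quaternionBasis.lift _ = _
    simp [QuaternionAlgebra.Basis.lift, quaternionBasis]⟩
  have h02 : gen 0 * gen 2 ∈ quaternionToCl.range := by
    have := neg_mem (mul_mem h01 h12)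
    rwa [mul_assoc, ← mul_assoc (gen 1), gen_mul_self, neg_one_mul, mul_neg, neg_neg] at this
  have hsq : ∀ i : Fin 3, gen i * gen i ∈ quaternionToCl.range := fun i => by
    simpa only [gen_mul_self] using neg_mem (one_mem quaternionToCl.range)
  have hswap : ∀ {i j : Fin 3}, i ≠ j → gen i * gen j ∈ quaternionToCl.range →
      gen j * gen i ∈ quaternionToCl.range := fun h h' => by
    simpa only [gen_mul_gen h.symm] using neg_mem h'
  refine mem_of_mem_evenOdd_zero quaternionToCl.range (fun i j => ?_) x.2.2
  fin_cases i <;> fin_cases j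
  · exact hsq 0
  · exact h01
  · exact h02
  · exact hswap (by decide) h01
  · exact hsq 1
  · exact h12
  · exact hswap (by decide) h02
  · exact hswap (by decide) h12
  · exact hsq 2

/-! ### Representations of the groups of the amalgam -/

section Rep

variable {R : Type*} [Ring R] [Algebra ℝ R]

/-- The homomorphism `cos α + sin α e₁e₂ ↦ cos α + sin α X` attached to a square root `X`
of `-1`. -/
def spinTwoHom (X : R) (hX : X * X = -1) : Spin 2 →* R :=
  (Complex.liftAux X hX : ℂ →* R).comp spinTwoToComplex

theorem spinTwoHom_S (X : R) (hX : X * X = -1) (α : ℝ) :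
    spinTwoHom X hX (S α) = Real.cos α • 1 + Real.sin α • X := by
  simp only [spinTwoHom, MonoidHom.comp_apply, spinTwoToComplex_S]
  exact (Complex.liftAux_apply X hX _).trans (by rw [Algebra.algebraMap_eq_smul_one])

/-- Any algebra homomorphism out of `Cl(2)` restricts to `spinTwoHom` on `Spin(2)`. -/
theorem algHom_apply_spin_two (F : Cl 2 →ₐ[ℝ] R) {X : R} (hX : X * X = -1)
    (hF : F (gen 0 * gen 1) = X) (x : Spin 2) : F x.1 = spinTwoHom X hX x := by
  have h : F.comp complexToCl = Complex.liftAux X hX := Complex.algHom_ext <| by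
    rw [AlgHom.comp_apply, complexToCl, Complex.liftAux_apply_I, Complex.liftAux_apply_I, hF]
  rw [← complexToCl_spinTwoToComplex, ← AlgHom.comp_apply, h]
  rfl

theorem commute_spinTwoHom {X Y : R} (hX : X * X = -1) (hY : Y * Y = -1) (h : Commute X Y)
    (x y : Spin 2) : Commute (spinTwoHom X hX x) (spinTwoHom Y hY y) := by
  change Commute (Complex.liftAux X hX _) (Complex.liftAux Y hY _)
  rw [Complex.liftAux_apply, Complex.liftAux_apply]
  exact (Algebra.commute_algebraMap_left _ _).add_left
    ((Algebra.commute_algebraMap_right _ _).add_right ((h.smul_left _).smul_right _))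

/-- For anticommuting square roots `X`, `Y` of `-1`, the homomorphism `Cl(3) → R` with
`e₁e₂ ↦ X` and `e₂e₃ ↦ Y`. It sends `e₁e₂e₃` to `1`, which forces
`e₁ ↦ -Y`, `e₂ ↦ YX`, `e₃ ↦ -X`. -/
def clThreeHom (X Y : R) (hX : X * X = -1) (hY : Y * Y = -1) (h : X * Y = -(Y * X)) :
    Cl 3 →ₐ[ℝ] R :=
  CliffordAlgebra.lift (negForm 3)
    ⟨-(LinearMap.proj 0 : (Fin 3 → ℝ) →ₗ[ℝ] ℝ).smulRight Y +
        (LinearMap.proj 1 : (Fin 3 → ℝ) →ₗ[ℝ] ℝ).smulRight (Y * X) -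
        (LinearMap.proj 2 : (Fin 3 → ℝ) →ₗ[ℝ] ℝ).smulRight X, fun v => by
      have h1 : Y * (Y * X) = -X := by rw [← mul_assoc, hY, neg_one_mul]
      have h2 : Y * X * Y = X := by rw [mul_assoc, h, mul_neg, h1, neg_neg]
      have h3 : Y * X * X = -Y := by rw [mul_assoc, hX, mul_neg_one]
      have h4 : X * (Y * X) = Y := by rw [← mul_assoc, h, neg_mul, h3, neg_neg]
      have h5 : Y * X * (Y * X) = -1 := by rw [mul_assoc, h4, hY]
      simp only [LinearMap.sub_apply, LinearMap.add_apply, LinearMap.neg_apply,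
        LinearMap.smulRight_apply, LinearMap.proj_apply, sub_mul, mul_sub, add_mul, mul_add,
        neg_mul, mul_neg, smul_mul_smul_comm, hX, hY, h, h1, h2, h3, h4, h5, negForm_apply,
        Fin.sum_univ_three, Algebra.algebraMap_eq_smul_one]
      module⟩

theorem clThreeHom_gen_zero_mul {X Y : R} (hX : X * X = -1) (hY : Y * Y = -1)
    (h : X * Y = -(Y * X)) : clThreeHom X Y hX hY h (gen 0 * gen 1) = X := by
  simp [clThreeHom, gen, ← mul_assoc, hY]

theorem clThreeHom_gen_one_mul {X Y : R} (hX : X * X = -1) (hY : Y * Y = -1)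
    (h : X * Y = -(Y * X)) : clThreeHom X Y hX hY h (gen 1 * gen 2) = Y := by
  simp [clThreeHom, gen, mul_assoc, hX]

/-- Injectivity holds because the even part of `Cl(3)` is a division ring. -/
theorem algHom_injective_on_spin_three [Nontrivial R] (F : Cl 3 →ₐ[ℝ] R) :
    Function.Injective fun x : Spin 3 => F x.1 := by
  intro x y hxy
  obtain ⟨a, ha⟩ := spin_three_mem_range x
  obtain ⟨b, hb⟩ := spin_three_mem_range y
  refine Subtype.ext ?_
  rw [← ha, ← hb]
  congr 1
  -- A ring homomorphism from the quaternions into a nontrivial ring is injective.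
  apply (F.comp quaternionToCl).toRingHom.injective
  change F (quaternionToCl a) = F (quaternionToCl b)
  exact (congrArg F ha).trans (hxy.trans (congrArg F hb).symm)

/-- The representation of `Piece b` attached to two square roots `X`, `Y` of `-1` which
anticommute in the case of `Spin(3)` and commute in the case of `Spin(2) × Spin(2)`. -/
def pieceHom (X Y : R) (hX : X * X = -1) (hY : Y * Y = -1) :
    ∀ b : Bool, (b = true → X * Y = -(Y * X)) → (b = false → Commute X Y) → (Piece b →* Rˣ)
  | true, h, _ =>
    ((clThreeHom X Y hX hY (h rfl) : Cl 3 →* R).comp (spinGroup (negForm 3)).subtype).toHomUnits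
  | false, _, h =>
    (MonoidHom.noncommCoprod (spinTwoHom X hX) (spinTwoHom Y hY)
      (commute_spinTwoHom hX hY (h rfl))).toHomUnits

theorem gen_map {m n : ℕ} (f : Fin m ↪ Fin n) (i : Fin m) :
    CliffordAlgebra.map (coordIsometry f) (gen i) = gen (f i) := by
  rw [gen, CliffordAlgebra.map_apply_ι]
  congr 1
  change Function.extend f (Pi.single i 1) 0 = _
  ext k
  by_cases hk : ∃ j, f j = k
  · obtain ⟨j, rfl⟩ := hk
    rw [f.injective.extend_apply]
    simp [Pi.single_apply]
  · rw [Function.extend_apply' _ _ _ hk]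
    have : k ≠ f i := fun h => hk ⟨i, h.symm⟩
    simp [this]

theorem pieceHom_pieceFst {X Y : R} (hX : X * X = -1) (hY : Y * Y = -1) (b : Bool) (h₁ h₂) :
    (pieceHom X Y hX hY b h₁ h₂).comp (pieceFst b) = (spinTwoHom X hX).toHomUnits := by
  ext x
  cases b
  · change spinTwoHom X hX x * spinTwoHom Y hY 1 = spinTwoHom X hX x
    rw [map_one, mul_one]
  · refine algHom_apply_spin_two ((clThreeHom X Y hX hY (h₁ rfl)).comp
      (CliffordAlgebra.map (coordIsometry Fin.castSuccEmb))) hX ?_ x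
    rw [AlgHom.comp_apply, map_mul, gen_map, gen_map]
    exact clThreeHom_gen_zero_mul hX hY (h₁ rfl)

theorem pieceHom_pieceSnd {X Y : R} (hX : X * X = -1) (hY : Y * Y = -1) (b : Bool) (h₁ h₂) :
    (pieceHom X Y hX hY b h₁ h₂).comp (pieceSnd b) = (spinTwoHom Y hY).toHomUnits := by
  ext x
  cases b
  · change spinTwoHom X hX 1 * spinTwoHom Y hY x = spinTwoHom Y hY x
    rw [map_one, one_mul]
  · refine algHom_apply_spin_two ((clThreeHom X Y hX hY (h₁ rfl)).comp
      (CliffordAlgebra.map (coordIsometry (Fin.succEmb 2)))) hY ?_ x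
    rw [AlgHom.comp_apply, map_mul, gen_map, gen_map]
    exact clThreeHom_gen_one_mul hX hY (h₁ rfl)

theorem pieceHom_injective [Nontrivial R] {X Y : R} (hX : X * X = -1) (hY : Y * Y = -1) (b : Bool)
    (h₁ h₂) (hb : b = true) : Function.Injective (pieceHom X Y hX hY b h₁ h₂) := by
  subst hb
  intro x y hxy
  exact algHom_injective_on_spin_three (clThreeHom X Y hX hY (h₁ rfl)) (congrArg Units.val hxy)

end Rep

/-! ### Spin families -/

theorem sup_eq_of_mem_of_ne_inf {n : ℕ} {p : Sym2 (Fin n)} {i : Fin n} (hi : i ∈ p)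
    (h : i ≠ p.inf) : i = p.sup := by
  induction p with
  | _ a b =>
    rw [Sym2.inf_mk] at h
    rw [Sym2.sup_mk]
    rcases Sym2.mem_iff.1 hi with rfl | rfl <;> grind

theorem isEdge_iff {n : ℕ} {V : Type*} (D : SimpleGraph V) (σ : Fin n ≃ V) (p : Pair (Fin n)) :
    IsEdge D σ p ↔ D.Adj (σ p.1.inf) (σ p.1.sup) := by
  obtain ⟨p, hp⟩ := p
  induction p with
  | _ a b =>
    rw [IsEdge, Sym2.map_mk, SimpleGraph.mem_edgeSet, Sym2.inf_mk, Sym2.sup_mk]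
    rcases le_total a b with h | h
    · rw [inf_of_le_left h, sup_of_le_right h]
    · rw [inf_of_le_right h, sup_of_le_left h, SimpleGraph.adj_comm]

section Family

variable {n : ℕ} {V : Type*} {D : SimpleGraph V} {σ : Fin n ≃ V}
  {R : Type*} [Ring R] [Algebra ℝ R]

/-- Square roots `X_i` of `-1`, one for each vertex of the diagram, such that `X_i` and `X_j`
anticommute if `i` and `j` are joined by an edge, and commute otherwise. -/
structure IsSpinFamily (D : SimpleGraph V) (σ : Fin n ≃ V) (X : Fin n → R) : Prop where
  mul_self : ∀ i, X i * X i = -1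
  anticomm : ∀ i j, D.Adj (σ i) (σ j) → X i * X j = -(X j * X i)
  comm : ∀ i j, ¬ D.Adj (σ i) (σ j) → Commute (X i) (X j)

variable {X : Fin n → R}

open Classical in
/-- The enveloping homomorphisms attached to a spin family. In each pair the smaller index plays
the role of `e₁e₂`, as in the definition of the connecting homomorphisms of the amalgam. -/
def IsSpinFamily.hom (hX : IsSpinFamily D σ X) (p : Pair (Fin n)) :
    (spinAmalgam D σ).G p →* Rˣ :=
  pieceHom (X p.1.inf) (X p.1.sup) (hX.mul_self _) (hX.mul_self _) _
    (fun h => hX.anticomm _ _ ((isEdge_iff D σ p).1 (of_decide_eq_true h)))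
    (fun h => hX.comm _ _ fun h' => of_decide_eq_false h ((isEdge_iff D σ p).2 h'))

/-- The composite with a connecting homomorphism depends only on the vertex; this is the
compatibility required of an enveloping morphism. -/
theorem IsSpinFamily.hom_comp_φ (hX : IsSpinFamily D σ X) (p : Pair (Fin n)) (i : Fin n)
    (hi : i ∈ p.1) :
    (hX.hom p).comp ((spinAmalgam D σ).φ p i hi) =
      (spinTwoHom (X i) (hX.mul_self i)).toHomUnits := by
  by_cases h : i = p.1.inf
  · have hφ : (spinAmalgam D σ).φ p i hi = pieceFst _ := if_pos h
    subst h
    rw [hφ]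
    exact pieceHom_pieceFst _ _ _ _ _
  · have hφ : (spinAmalgam D σ).φ p i hi = pieceSnd _ := if_neg h
    obtain rfl := sup_eq_of_mem_of_ne_inf hi h
    rw [hφ]
    exact pieceHom_pieceSnd _ _ _ _ _

theorem IsSpinFamily.hom_S (hX : IsSpinFamily D σ X) (p : Pair (Fin n)) (i : Fin n)
    (hi : i ∈ p.1) (α : ℝ) :
    (hX.hom p ((spinAmalgam D σ).φ p i hi (S α)) : R) =
      Real.cos α • (1 : R) + Real.sin α • X i := by
  rw [← spinTwoHom_S (X i) (hX.mul_self i)]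
  exact congrArg Units.val (DFunLike.congr_fun (hX.hom_comp_φ p i hi) (S α))

theorem IsSpinFamily.hom_injective [Nontrivial R] (hX : IsSpinFamily D σ X) (p : Pair (Fin n))
    (hp : IsEdge D σ p) : Function.Injective (hX.hom p) :=
  pieceHom_injective _ _ _ _ _ (by simpa using hp)

/-- A spin family in a nontrivial algebra separates `-1` from `1` in `Spin(Π)`. -/
theorem IsSpinFamily.negOneAt_ne_one [Nontrivial R] (hX : IsSpinFamily D σ X)
    (p : Pair (Fin n)) (i : Fin n) (hi : i ∈ p.1) : negOneAt D σ p i hi ≠ 1 := by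
  intro h
  have h1 := congrArg ((spinAmalgam D σ).lift hX.hom
    fun p q j hp hq => (hX.hom_comp_φ p j hp).trans (hX.hom_comp_φ q j hq).symm) h
  rw [map_one, negOneAt] at h1
  have h2 := congrArg Units.val
    (((spinAmalgam D σ).lift_universalHom hX.hom _ p _).symm.trans h1)
  rw [negOne_eq_S_pi, hX.hom_S] at h2
  simp only [Real.cos_pi, Real.sin_pi, zero_smul, add_zero, neg_smul, one_smul,
    Units.val_one] at h2
  have h3 : (algebraMap ℝ R) (-1) = algebraMap ℝ R 1 := by simpa using h2
  have := (algebraMap ℝ R).injective h3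
  norm_num at this

end Family

/-! ### The Berman generators -/

section Berman

attribute [local instance 100] LieRing.ofAssociativeRing

variable {n : ℕ} (A : Matrix (Fin n) (Fin n) ℤ)

theorem berman_lie {i j : Fin n} (hij : i ≠ j) :
    ⁅kmE A i - kmF A i, kmE A j - kmF A j⁆ = ⁅kmE A i, kmE A j⁆ + ⁅kmF A i, kmF A j⁆ := by
  have h : ⁅kmF A i, kmE A j⁆ = 0 := by rw [← lie_skew, km_ef_ne A hij.symm, neg_zero]
  rw [sub_lie, lie_sub, lie_sub, km_ef_ne A hij, h]
  abel

theorem berman_lie_eq_zero {i j : Fin n} (hij : i ≠ j) (h : A i j = 0) :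
    ⁅berman A i, berman A j⁆ = 0 := by
  refine Subtype.ext ?_
  change ⁅kmE A i - kmF A i, kmE A j - kmF A j⁆ = 0
  have h1 := km_adE A i j
  have h2 := km_adF A i j
  rw [h] at h1 h2
  rw [berman_lie A hij]
  simpa using congrArg₂ (· + ·) h1 h2

/-- The Serre relations and `⁅e_i, f_i⁆ = h_i` combine to Berman's relation. -/
theorem berman_lie_lie {i j : Fin n} (hij : i ≠ j) (h : A i j = -1) :
    ⁅berman A i, ⁅berman A i, berman A j⁆⁆ = -berman A j := by
  refine Subtype.ext ?_
  change ⁅kmE A i - kmF A i, ⁅kmE A i - kmF A i, kmE A j - kmF A j⁆⁆ = -(kmE A j - kmF A j)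
  have h1 : ⁅kmE A i, ⁅kmE A i, kmE A j⁆⁆ = 0 := by simpa [h] using km_adE A i j
  have h2 : ⁅kmF A i, ⁅kmF A i, kmF A j⁆⁆ = 0 := by simpa [h] using km_adF A i j
  have h3 : ⁅kmE A i, ⁅kmF A i, kmF A j⁆⁆ = kmF A j := by
    rw [leibniz_lie, km_ef, km_hf, km_ef_ne A hij, lie_zero, h]
    simp
  have h4 : ⁅kmF A i, ⁅kmE A i, kmE A j⁆⁆ = kmE A j := by
    rw [leibniz_lie, ← lie_skew (kmF A i) (kmE A i), km_ef, neg_lie, km_he,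
      ← lie_skew (kmF A i) (kmE A j), km_ef_ne A hij.symm, neg_zero, lie_zero, h]
    simp
  rw [berman_lie A hij, sub_lie, lie_add, lie_add, h1, h2, h3, h4]
  abel

/-- With `a² = -1/4`, the relation `a²b - 2aba + ba² = -b` says `aba = b/4`. -/
theorem anticommute_of_lie_lie {R : Type*} [Ring R] [Algebra ℝ R] {a b : R}
    (ha : a * a = -((1 / 4 : ℝ) • (1 : R))) (h : ⁅a, ⁅a, b⁆⁆ = -b) : a * b = -(b * a) := by
  rw [LieRing.of_associative_ring_bracket, LieRing.of_associative_ring_bracket] at h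
  have h1 : a * (a * b) = -((1 / 4 : ℝ) • b) := by
    rw [← mul_assoc, ha, neg_mul, smul_mul_assoc, one_mul]
  have h2 : b * a * a = -((1 / 4 : ℝ) • b) := by
    rw [mul_assoc, ha, mul_neg, mul_smul_comm, mul_one]
  rw [mul_sub, sub_mul, h1, h2] at h
  have h3 : a * b * a = (1 / 4 : ℝ) • b := by
    have h4 : (2 : ℝ) • (a * b * a) = (1 / 2 : ℝ) • b := by
      rw [← mul_assoc] at h
      calc (2 : ℝ) • (a * b * a) = -(-((1 / 4 : ℝ) • b) - a * b * a -
            (a * b * a - -((1 / 4 : ℝ) • b))) - (1 / 2 : ℝ) • b := by module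
        _ = (1 / 2 : ℝ) • b := by rw [h]; module
    have h5 := congrArg ((1 / 2 : ℝ) • ·) h4
    simp only [smul_smul] at h5
    norm_num at h5
    simpa using h5
  have h4 := congrArg (a * ·) h3
  simp only [← mul_assoc, ha] at h4
  simp only [neg_mul, smul_mul_assoc, one_mul, mul_smul_comm] at h4
  have h5 := congrArg ((4 : ℝ) • ·) h4
  simp only [smul_neg, smul_smul] at h5
  norm_num at h5
  exact h5.symm

theorem isSpinFamily_spinMatrix {V : Type*} {D : SimpleGraph V} {σ : Fin n ≃ V} {s : ℕ}
    {μ : CompactRep (cartan D σ) s} (hμ : IsGeneralizedSpinRep μ) :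
    IsSpinFamily D σ (spinMatrix μ) where
  mul_self i := by
    rw [spinMatrix, smul_mul_smul_comm, hμ i, smul_neg, smul_smul]
    norm_num
  anticomm i j h := by
    have hij : i ≠ j := fun e => h.ne (congrArg σ e)
    have h1 := congrArg μ (berman_lie_lie (cartan D σ) hij (by simp [cartan, hij, h]))
    rw [LieHom.map_lie, LieHom.map_lie, map_neg] at h1
    rw [spinMatrix, spinMatrix, smul_mul_smul_comm, smul_mul_smul_comm, ← smul_neg,
      anticommute_of_lie_lie (hμ i) h1]
  comm i j h := by
    rcases eq_or_ne i j with rfl | hij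
    · exact Commute.refl _
    have h1 := congrArg μ (berman_lie_eq_zero (cartan D σ) hij (by simp [cartan, hij, h]))
    rw [LieHom.map_lie, map_zero, LieRing.of_associative_ring_bracket, sub_eq_zero] at h1
    exact (Commute.smul_left h1 _).smul_right _

end Berman

/-! ### A spin family for every diagram -/

section Existence

variable {n : ℕ} {V : Type*} (D : SimpleGraph V) (σ : Fin n ≃ V)

open Classical in
/-- A bilinear form on `𝔽₂ⁿ`, given by its values on the standard basis, with `β(e_i, e_i) = 1`
and with `β(e_i, e_j) + β(e_j, e_i) = 1` if and only if `i ≠ j` are joined by an edge. -/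
def cocycle (i j : Fin n) : ZMod 2 :=
  if i = j then 1 else if i < j ∧ D.Adj (σ i) (σ j) then 1 else 0

/-- The sign `(-1)^a` of `a ∈ 𝔽₂`. -/
def sign (a : ZMod 2) : ℝ := if a = 0 then 1 else -1

theorem sign_add (a b : ZMod 2) : sign (a + b) = sign a * sign b := by
  have h : ∀ a b : ZMod 2, a = 0 ∨ b = 0 ∨ (a ≠ 0 ∧ b ≠ 0 ∧ a + b = 0) := by decide
  rcases h a b with h1 | h1 | ⟨h1, h2, h3⟩
  · simp [sign, h1]
  · simp [sign, h1]
  · simp [sign, h1, h2, h3]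

theorem sign_zero : sign 0 = 1 := if_pos rfl

theorem sign_one : sign 1 = -1 := if_neg one_ne_zero

/-- The operator `f ↦ (v ↦ (-1)^{β(e_i, v)} f(v + e_i))` on the functions on `𝔽₂ⁿ`. -/
def twistedShift (i : Fin n) : Module.End ℝ ((Fin n → ZMod 2) → ℝ) where
  toFun f v := sign (∑ k, cocycle D σ i k * v k) * f (v + Pi.single i 1)
  map_add' f g := by ext v; simp [mul_add]
  map_smul' c f := by ext v; simp [mul_left_comm]

theorem twistedShift_mul_apply (i j : Fin n) (f : (Fin n → ZMod 2) → ℝ) (v : Fin n → ZMod 2) :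
    (twistedShift D σ i * twistedShift D σ j) f v =
      sign (cocycle D σ j i) * (sign (∑ k, cocycle D σ i k * v k) *
        sign (∑ k, cocycle D σ j k * v k) * f (v + Pi.single i 1 + Pi.single j 1)) := by
  change sign _ * (sign (∑ k, cocycle D σ j k * (v + Pi.single i 1 : Fin n → ZMod 2) k) * f _) = _
  have h : ∑ k, cocycle D σ j k * (v + Pi.single i 1 : Fin n → ZMod 2) k =
      ∑ k, cocycle D σ j k * v k + cocycle D σ j i := by
    simp [mul_add, Finset.sum_add_distrib, Pi.single_apply]
  rw [h, sign_add]
  ring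

/-- The commutation sign of two twisted shifts is `(-1)^{β(e_i, e_j) + β(e_j, e_i)}`. -/
theorem twistedShift_mul_comm (i j : Fin n) :
    twistedShift D σ i * twistedShift D σ j =
      sign (cocycle D σ i j + cocycle D σ j i) • (twistedShift D σ j * twistedShift D σ i) := by
  have hsq : ∀ a, sign a * sign a = 1 := fun a => by
    unfold sign
    split_ifs <;> norm_num
  refine LinearMap.ext fun f => ?_
  funext v
  rw [LinearMap.smul_apply, Pi.smul_apply, smul_eq_mul, twistedShift_mul_apply,
    twistedShift_mul_apply, add_right_comm v, sign_add]
  linear_combination (-sign (cocycle D σ j i) * sign (∑ k, cocycle D σ i k * v k) *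
    sign (∑ k, cocycle D σ j k * v k) * f (v + Pi.single j 1 + Pi.single i 1)) *
      hsq (cocycle D σ i j)

theorem isSpinFamily_twistedShift : IsSpinFamily D σ (twistedShift D σ) where
  mul_self i := by
    refine LinearMap.ext fun f => ?_
    funext v
    have h : v + Pi.single i 1 + Pi.single i 1 = v := by
      rw [add_assoc, ← Pi.single_add, CharTwo.add_self_eq_zero, Pi.single_zero, add_zero]
    rw [twistedShift_mul_apply, ← sign_add, CharTwo.add_self_eq_zero, h, sign_zero, cocycle,
      if_pos rfl, sign_one]
    simp
  anticomm i j h := by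
    have hij : i ≠ j := fun e => h.ne (congrArg σ e)
    have hβ : cocycle D σ i j + cocycle D σ j i = 1 := by
      rcases hij.lt_or_gt with h' | h' <;>
        simp [cocycle, hij, hij.symm, h, h.symm, h', h'.not_gt]
    rw [twistedShift_mul_comm, hβ, sign_one]
    exact neg_one_smul ℝ (twistedShift D σ j * twistedShift D σ i)
  comm i j h := by
    have hβ : cocycle D σ i j + cocycle D σ j i = 0 := by
      rcases eq_or_ne i j with rfl | hij
      · exact CharTwo.add_self_eq_zero _
      · have h' : ¬ D.Adj (σ j) (σ i) := fun e => h e.symm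
        simp [cocycle, hij, hij.symm, h, h']
    have := twistedShift_mul_comm D σ i j
    rwa [hβ, sign_zero, one_smul] at this

end Existence

/-! ### The central element `-1` -/

section NegOne

variable {n : ℕ} {V : Type*} (D : SimpleGraph V) (σ : Fin n ≃ V)

theorem negOneAt_pair_eq (p q : Pair (Fin n)) (i : Fin n) (hp : i ∈ p.1) (hq : i ∈ q.1) :
    negOneAt D σ p i hp = negOneAt D σ q i hq :=
  DFunLike.congr_fun ((spinAmalgam D σ).universalMorphism.compat p q i hp hq) negOne

theorem ε₁₂_negOne_eq : ε₁₂ negOne = ε₂₃ negOne :=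
  Subtype.ext <| by
    change CliffordAlgebra.map _ (-1) = CliffordAlgebra.map _ (-1)
    simp

theorem pieceFst_negOne (b : Bool) (hb : b = true) : pieceFst b negOne = pieceSnd b negOne := by
  subst hb
  exact ε₁₂_negOne_eq

/-- At an edge both connecting homomorphisms send `-1` to the element `-1` of `Spin(3)`. -/
theorem negOneAt_eq_of_isEdge (p : Pair (Fin n)) (hp : IsEdge D σ p) (i j : Fin n)
    (hi : i ∈ p.1) (hj : j ∈ p.1) : negOneAt D σ p i hi = negOneAt D σ p j hj := by
  have h : ∀ (k : Fin n) (hk : k ∈ p.1),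
      (spinAmalgam D σ).φ p k hk negOne = pieceFst _ negOne := by
    intro k hk
    by_cases e : k = p.1.inf
    · have hφ : (spinAmalgam D σ).φ p k hk = pieceFst _ := if_pos e
      exact congrArg (fun g : Spin 2 →* _ => g negOne) hφ
    · have hφ : (spinAmalgam D σ).φ p k hk = pieceSnd _ := if_neg e
      refine (congrArg (fun g : Spin 2 →* _ => g negOne) hφ).trans ?_
      exact (pieceFst_negOne _ (by simpa using hp)).symm
  rw [negOneAt, negOneAt, h, h]

theorem negOneAt_eq_of_reachable {u v : V} (h : D.Reachable u v) (p q : Pair (Fin n))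
    (hi : σ.symm u ∈ p.1) (hj : σ.symm v ∈ q.1) :
    negOneAt D σ p _ hi = negOneAt D σ q _ hj := by
  obtain ⟨w⟩ := h
  induction w generalizing p with
  | nil => exact negOneAt_pair_eq D σ p q _ hi hj
  | @cons a b c hab w ih =>
    have hne : σ.symm a ≠ σ.symm b := fun e => hab.ne (σ.symm.injective e)
    let r : Pair (Fin n) := ⟨s(σ.symm a, σ.symm b), by simpa using hne⟩
    have hr : IsEdge D σ r := by simpa [IsEdge, r] using hab
    calc negOneAt D σ p _ hi = negOneAt D σ r _ (Sym2.mem_mk_left _ _) :=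
          negOneAt_pair_eq D σ p r _ hi _
      _ = negOneAt D σ r _ (Sym2.mem_mk_right _ _) := negOneAt_eq_of_isEdge D σ r hr _ _ _ _
      _ = negOneAt D σ q _ hj := ih r _ hj

end NegOne

end SpinCover

end

theorem mainTheorem9 {n : ℕ} {V : Type*} (D : SimpleGraph V) (hD : D.Connected)
    (σ : Fin n ≃ V) :
    (∀ (s : ℕ) (_ : 1 ≤ s) (μ : SpinCover.CompactRep (SpinCover.cartan D σ) s)
        (_ : SpinCover.IsGeneralizedSpinRep μ),
      ∃ (H : SpinCover.Pair (Fin n) → Subgroup (Matrix.GeneralLinearGroup (Fin s) ℂ))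
        (Ψ : (SpinCover.spinAmalgam D σ).EnvelopingMorphism ↥(⨆ p, H p)),
        (∀ p, ((⨆ p, H p).subtype.comp (Ψ.hom p)).range = H p) ∧
        (∀ p, SpinCover.IsEdge D σ p → Function.Injective (Ψ.hom p)) ∧
        (∀ (p : SpinCover.Pair (Fin n)) (i : Fin n) (hi : i ∈ p.1) (α : ℝ),
          (((Ψ.hom p ((SpinCover.spinAmalgam D σ).φ p i hi (SpinCover.S α)) :
              ↥(⨆ p, H p)) : Matrix.GeneralLinearGroup (Fin s) ℂ) :
                Matrix (Fin s) (Fin s) ℂ) =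
            Real.cos α • (1 : Matrix (Fin s) (Fin s) ℂ) +
              Real.sin α • SpinCover.spinMatrix μ i)) ∧
    (∀ (p q : SpinCover.Pair (Fin n)) (i j : Fin n) (hi : i ∈ p.1) (hj : j ∈ q.1),
      SpinCover.negOneAt D σ p i hi = SpinCover.negOneAt D σ q j hj) ∧
    (∀ (p : SpinCover.Pair (Fin n)) (i : Fin n) (hi : i ∈ p.1),
      SpinCover.negOneAt D σ p i hi ≠ 1) := by
  refine ⟨fun s hs μ hμ => ?_, fun p q i j hi hj => ?_, fun p i hi => ?_⟩
  · have hX := SpinCover.isSpinFamily_spinMatrix hμ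
    have : NeZero s := ⟨by lia⟩
    refine ⟨fun p => (hX.hom p).range, .ofHoms hX.hom fun p q j hp hq =>
      (hX.hom_comp_φ p j hp).trans (hX.hom_comp_φ q j hq).symm, fun p => rfl, fun p hp => ?_,
      fun p i hi α => hX.hom_S p i hi α⟩
    exact fun x y hxy => hX.hom_injective p hp (congrArg Subtype.val hxy)
  · obtain ⟨u, rfl⟩ := σ.symm.surjective i
    obtain ⟨v, rfl⟩ := σ.symm.surjective j
    exact SpinCover.negOneAt_eq_of_reachable D σ (hD.preconnected u v) p q hi hj
  · exact (SpinCover.isSpinFamily_twistedShift D σ).negOneAt_ne_one p i hi
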